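/- Let $M$ be a connected smooth manifold (Hausdorff, second countable) of dimension $m>2$ and let $g$ be a smooth symmetric $(0,2)$-tensor field on $M$ whose set $\Sigma$ of points of non-maximal rank is non-empty. Assume that $(M,g)$ is a transverse Riemann–Lorentz space with tangent radical, that is: 1. in every local coordinate system the function $\det(g_{ab})$ has non-zero differential at the points of $\Sigma$ (so $\Sigma$ is a smooth hypersurface, and the radical $\mathrm{Rad}_p=\{v\in T_pM : g(v,\cdot)=0\}$ is a line for each $p\in\Sigma$); 2. $\mathrm{Rad}_p\subset T_p\Sigma$ for all $p\in\Sigma$; 3. at each point of $M\setminus\Sigma$ the form $g$ is either positive definite or of Lorentz signature $(m-1,1)$ (so, by 1, the signature changes from Riemann to Lorentz across $\Sigma$). Let $A,B$ be any smooth sections of $TM|_\Sigma$ (vector fields along $\Sigma$, not necessarily tangent to $\Sigma$). An extension of $A$ is a smooth vector field $\mathcal A$ on $M$ with $\mathcal A|_\Sigma=A$. We say that $\mathrm{Ric}(A,B)$ is well-defined if, for all extensions $\mathcal A,\mathcal B$ of $A,B$, the Ricci curvature $\mathrm{Ric}(\mathcal A,\mathcal B)$ of the Levi-Civita connection of $g$,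 which is a smooth function on $M\setminus\Sigma$, extends to a smooth function on $M$, and the restriction of this smooth function to $\Sigma$ depends only on $A$ and $B$ and not on the extensions $\mathcal A,\mathcal B$. Then $\mathrm{Ric}(A,B)$ is not well-defined. No flatness condition on $\Sigma$ is imposed: the conclusion holds for every such $(M,g)$ and all $A,B$, in particular also when $\Sigma$ is $III$-flat (that is, when the tensor fields $II$ and $\mathcal H$ induced on $\Sigma$ vanish on its canonical screen distribution). -/

import Mathlib

open scoped Manifold ContDiff Topology

noncomputable section

namespace SingularSpace

/-- The model space `ℝᵐ`. -/
abbrev Model (m : ℕ) : Type := EuclideanSpace ℝ (Fin m)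

/-- The `a`-th standard basis vector of `ℝᵐ`. -/
def stdVec {m : ℕ} (a : Fin m) : Model m := EuclideanSpace.single a (1 : ℝ)

/-! ### Local differential geometry of a field of bilinear forms on `ℝᵐ` -/

section Local

variable {m : ℕ}

/-- The matrix `(g_ab)` at `x` of a field `G` of bilinear forms on `ℝᵐ`. -/
def gram (G : Model m → Model m →L[ℝ] Model m →L[ℝ] ℝ) (x : Model m) :
    Matrix (Fin m) (Fin m) ℝ :=
  Matrix.of fun a b => G x (stdVec a) (stdVec b)

/-- Christoffel symbols of the first kind,
`½ (∂_u g(v,w) + ∂_v g(w,u) - ∂_w g(u,v))` for constant fields `u`, `v`, `w`. -/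
def christoffelFirst (G : Model m → Model m →L[ℝ] Model m →L[ℝ] ℝ) (x : Model m)
    (u v w : Model m) : ℝ :=
  (1 / 2) * (fderiv ℝ G x u v w + fderiv ℝ G x v w u - fderiv ℝ G x w u v)

/-- Christoffel symbols of the second kind: where `G x` is nondegenerate, this is `∇_u v` at `x` for
constant fields `u`, `v`, with `∇` the Levi-Civita connection of `G`. -/
def christoffel (G : Model m → Model m →L[ℝ] Model m →L[ℝ] ℝ) (x : Model m)
    (u v : Model m) : Model m :=
  WithLp.toLp 2 ((gram G x)⁻¹.mulVec fun l => christoffelFirst G x u v (stdVec l))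

/-- The curvature `R(u,v)w = ∇_u ∇_v w - ∇_v ∇_u w` for constant fields `u`, `v`, `w`. -/
def curvature (G : Model m → Model m →L[ℝ] Model m →L[ℝ] ℝ) (x : Model m)
    (u v w : Model m) : Model m :=
  fderiv ℝ (fun y => christoffel G y v w) x u - fderiv ℝ (fun y => christoffel G y u w) x v
    + christoffel G x u (christoffel G x v w) - christoffel G x v (christoffel G x u w)

/-- The Ricci curvature as the trace of `w ↦ R(u,w)v`, that is `∑ ⟨R(u,Eᵢ)v,Eᵢ⟩ / ⟨Eᵢ,Eᵢ⟩` in an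
orthogonal frame. (The opposite trace convention only changes the sign.) -/
def ricciLocal (G : Model m → Model m →L[ℝ] Model m →L[ℝ] ℝ) (x : Model m)
    (u v : Model m) : ℝ :=
  ∑ i : Fin m, (curvature G x u (stdVec i) v) i

end Local

/-! ### Singular metrics on a manifold -/

/-- A smooth symmetric `(0,2)`-tensor field on a smooth `m`-manifold (no nondegeneracy). -/
structure SymmTensor (m : ℕ) (M : Type*) [TopologicalSpace M] [ChartedSpace (Model m) M]
    [IsManifold (𝓡 m) ∞ M] where
  /-- the bilinear form at each point -/
  form : ∀ p : M, TangentSpace (𝓡 m) p →L[ℝ] TangentSpace (𝓡 m) p →L[ℝ] ℝ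
  symm : ∀ (p : M) (v w : TangentSpace (𝓡 m) p), form p v w = form p w v
  smooth : ContMDiff (𝓡 m) ((𝓡 m).prod 𝓘(ℝ, Model m →L[ℝ] Model m →L[ℝ] ℝ)) ∞
    (fun p => Bundle.TotalSpace.mk' (Model m →L[ℝ] Model m →L[ℝ] ℝ)
      (E := fun p : M => TangentSpace (𝓡 m) p →L[ℝ] TangentSpace (𝓡 m) p →L[ℝ] ℝ) p (form p))

section Manifold

variable {m : ℕ} {M : Type*} [TopologicalSpace M] [ChartedSpace (Model m) M]
  [IsManifold (𝓡 m) ∞ M]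

/-- `v` lies in the radical of `g` at `p`: it is orthogonal to the whole tangent space. -/
def InRadical (g : SymmTensor m M) (p : M) (v : TangentSpace (𝓡 m) p) : Prop :=
  ∀ w : TangentSpace (𝓡 m) p, g.form p v w = 0

/-- The set `Σ` of points where `g` fails to have maximal rank. -/
def singularSet (g : SymmTensor m M) : Set M :=
  {p | ∃ v : TangentSpace (𝓡 m) p, v ≠ 0 ∧ InRadical g p v}

/-- The coordinate expression of `g` in the chart `e` (meaningful on `e.target`). -/
def chartMetric (g : SymmTensor m M) (e : OpenPartialHomeomorph M (Model m)) (x : Model m) :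
    Model m →L[ℝ] Model m →L[ℝ] ℝ :=
  let T : Model m →L[ℝ] Model m := mfderiv (𝓡 m) (𝓡 m) e.symm x
  let b : Model m →L[ℝ] Model m →L[ℝ] ℝ := g.form (e.symm x)
  b.bilinearComp T T

/-- `(M, g)` is transverse: in every coordinate system `det (g_ab)` has nonzero differential at
the points of `Σ`. -/
def IsTransverse (g : SymmTensor m M) : Prop :=
  ∀ e ∈ IsManifold.maximalAtlas (𝓡 m) ∞ M, ∀ p ∈ e.source, p ∈ singularSet g →
    fderiv ℝ (fun x => (gram (chartMetric g e) x).det) (e p) ≠ 0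

/-- `v ∈ T_pM` is tangent to `Σ`: it is annihilated by the differential of every smooth function
vanishing on `Σ`. -/
def TangentToSingularSet (g : SymmTensor m M) (p : M) (v : TangentSpace (𝓡 m) p) : Prop :=
  ∀ φ : M → ℝ, ContMDiff (𝓡 m) 𝓘(ℝ, ℝ) ∞ φ → (∀ q ∈ singularSet g, φ q = 0) →
    mfderiv (𝓡 m) 𝓘(ℝ, ℝ) φ p v = 0

/-- `g` has tangent radical: `Rad_p ⊆ T_pΣ` at every `p ∈ Σ`. -/
def HasTangentRadical (g : SymmTensor m M) : Prop :=
  ∀ p ∈ singularSet g, ∀ v : TangentSpace (𝓡 m) p,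
    InRadical g p v → TangentToSingularSet g p v

/-- `g` is positive definite at `p`. -/
def IsRiemannAt (g : SymmTensor m M) (p : M) : Prop :=
  ∀ v : TangentSpace (𝓡 m) p, v ≠ 0 → 0 < g.form p v v

/-- `g` has Lorentz signature (exactly one minus sign) at `p`. -/
def IsLorentzAt (g : SymmTensor m M) (p : M) : Prop :=
  ∃ v : TangentSpace (𝓡 m) p, g.form p v v < 0 ∧
    ∀ w : TangentSpace (𝓡 m) p, w ≠ 0 → g.form p v w = 0 → 0 < g.form p w w

/-- Away from `Σ` the metric is Riemannian or Lorentzian. For a transverse `g` the determinant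
changes sign across `Σ`, so that the signature changes from Riemann to Lorentz there. -/
def IsRiemannLorentz (g : SymmTensor m M) : Prop :=
  ∀ p ∉ singularSet g, IsRiemannAt g p ∨ IsLorentzAt g p

/-- The Ricci curvature of `g` at `p`, computed in the chart `e`. -/
def ricciInChart (g : SymmTensor m M) (e : OpenPartialHomeomorph M (Model m)) (p : M)
    (u v : TangentSpace (𝓡 m) p) : ℝ :=
  ricciLocal (chartMetric g e) (e p)
    (mfderiv (𝓡 m) (𝓡 m) e p u) (mfderiv (𝓡 m) (𝓡 m) e p v)

/-- The Ricci curvature of the Levi-Civita connection of `g` at a point `p ∉ Σ`. -/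
def ricci (g : SymmTensor m M) (p : M) (u v : TangentSpace (𝓡 m) p) : ℝ :=
  ricciInChart g (chartAt (Model m) p) p u v

/-- Smooth vector fields on (a subset `U` of) `M`. -/
def IsSmoothField (A : ∀ p : M, TangentSpace (𝓡 m) p) (U : Set M) : Prop :=
  ContMDiffOn (𝓡 m) (𝓡 m).tangent ∞ (fun p => (⟨p, A p⟩ : TangentBundle (𝓡 m) M)) U

/-- Vector fields along `Σ`, not necessarily tangent to `Σ` and not yet assumed smooth. -/
abbrev FieldAlong (g : SymmTensor m M) : Type _ :=
  ∀ p : singularSet g, TangentSpace (𝓡 m) (p : M)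

/-- A vector field along `Σ` is smooth if near each point of `Σ` it is the restriction of a
smooth vector field of `M`. -/
def IsSmoothAlong (g : SymmTensor m M) (A : FieldAlong g) : Prop :=
  ∀ p : singularSet g, ∃ U ∈ 𝓝 (p : M), ∃ A' : ∀ q : M, TangentSpace (𝓡 m) q,
    IsSmoothField A' U ∧ ∀ q : singularSet g, (q : M) ∈ U → A' (q : M) = A q

/-- `A'` is an extension of `A`: a smooth vector field on `M` with restriction `A` to `Σ`. -/
def IsExtension (g : SymmTensor m M) (A : FieldAlong g)
    (A' : ∀ p : M, TangentSpace (𝓡 m) p) : Prop :=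
  IsSmoothField A' Set.univ ∧ ∀ q : singularSet g, A' (q : M) = A q

/-- `f`, regarded on `M ∖ Σ` only, has a good limit on `Σ`, namely the smooth function `F` on
`M`. -/
def HasGoodLimit (g : SymmTensor m M) (f F : M → ℝ) : Prop :=
  ContMDiff (𝓡 m) 𝓘(ℝ, ℝ) ∞ F ∧ ∀ p ∉ singularSet g, F p = f p

/-- `Ric(A,B)` is well-defined, for fields `A`, `B` along `Σ`: for all extensions `A'`, `B'` the
function `Ric(A',B')` on `M ∖ Σ` has a good limit on `Σ`, and the restriction of this limit to `Σ`
is a function `r` depending on `A` and `B` only. -/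
def RicciWellDefined (g : SymmTensor m M) (A B : FieldAlong g) : Prop :=
  ∃ r : singularSet g → ℝ, ∀ A' B' : ∀ p : M, TangentSpace (𝓡 m) p,
    IsExtension g A A' → IsExtension g B B' →
      ∃ F : M → ℝ, HasGoodLimit g (fun p => ricci g p (A' p) (B' p)) F ∧
        ∀ q : singularSet g, F (q : M) = r q

end Manifold

end SingularSpace

end

/-! If `Ric(A,B)` were well-defined, replacing `A`, `B` by other extensions would not change the
limit on `Σ`. Polarizing over the extensions `A'`, `A' + X`, `B'`, `B' + X`, with `X` any smooth
field vanishing on `Σ`, shows that `Ric(X,X)` must tend to `0` on `Σ`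
(`RicciWellDefined.exists_continuous`). The proof exhibits an `X` violating this.

Near `p ∈ Σ` write `δ = det (g_ab)` and take `X = δ w` with `w` constant in coordinates, cut off by
a bump function. Christoffel symbols have the form `N / δ` with `N` smooth, so `Ric(X,X) = δ²
Ric(w,w)` is a polynomial in `δ`, `dδ`, `N`, `dN`, hence continuous across `Σ`
(`sq_det_mul_ricciLocal`, `continuousAt_ricciNum`).

Its value at `p` is explicit (`ricciNum_eq`). There the adjugate of the Gram matrix is `c R Rᵀ` with
`R` spanning the radical, so by Jacobi's formula `dδ(v) = c (∂_v g)(R,R)`, and `N(u,v)` is a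
multiple of `R`. Since `R` is tangent to `Σ`, `dδ(R) = 0`, and what remains is `-dδ(w)²/2 + dδ(w)²/4
= -dδ(w)²/4`. Transversality provides `w` with `dδ(w) ≠ 0`, so the limit at `p` is not `0`. -/

noncomputable section

namespace SingularSpace

set_option maxSynthPendingDepth 6

/-! ### Adjugates of singular symmetric matrices and the derivative of the determinant. -/

section LinearAlgebra

variable {ι : Type*} [Fintype ι] [DecidableEq ι]

/-- If some entry of the adjugate in row `i` is nonzero, a kernel vector vanishing at `i` is zero. -/
theorem eq_zero_of_mulVec_eq_zero_of_adjugate_ne_zero {A : Matrix ι ι ℝ} {i j : ι}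
    (hij : A.adjugate i j ≠ 0) {v : ι → ℝ} (hv : A.mulVec v = 0) (hvi : v i = 0) : v = 0 := by
  rw [Matrix.adjugate_apply] at hij
  -- `hij` now says that `A` with row `j` replaced by the `i`-th unit vector is invertible; this
  -- matrix also kills `v`.
  refine Matrix.eq_zero_of_mulVec_eq_zero hij ?_
  ext k
  by_cases hk : k = j
  · subst hk
    simp [Matrix.mulVec, Matrix.updateRow_self, single_dotProduct, hvi]
  · have := congrFun hv k
    simpa [Matrix.mulVec, Matrix.updateRow_ne hk] using this

/-- The nonzero adjugate of a singular symmetric matrix is a multiple of `R Rᵀ`, with `R` spanning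
the kernel. -/
theorem exists_adjugate_eq_smul_vecMulVec {A : Matrix ι ι ℝ} (hA : A.IsSymm) (hdet : A.det = 0)
    (hadj : A.adjugate ≠ 0) :
    ∃ (c : ℝ) (R : ι → ℝ), R ≠ 0 ∧ A.mulVec R = 0 ∧ ∀ k l, A.adjugate k l = c * (R k * R l) := by
  obtain ⟨i, j, hij⟩ : ∃ i j, A.adjugate i j ≠ 0 := by
    by_contra! h
    exact hadj (Matrix.ext h)
  have hsymm : ∀ k l, A.adjugate k l = A.adjugate l k := fun k l => by
    have h : A.adjugate.transpose = A.adjugate := by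
      rw [Matrix.adjugate_transpose, hA.eq]
    exact congrFun (congrFun h.symm k) l
  have hker : ∀ k, A.mulVec (fun l => A.adjugate l k) = 0 := fun k => by
    ext l
    have h := congrFun (congrFun (Matrix.mul_adjugate A) l) k
    simpa [hdet, Matrix.mul_apply, Matrix.mulVec, dotProduct] using h
  -- Columns `k` and `j` both lie in the kernel, and this combination of them vanishes at index `i`:
  -- the adjugate has rank one.
  have hprop : ∀ k l, A.adjugate i j * A.adjugate l k = A.adjugate i k * A.adjugate l j := by
    intro k l
    have h := eq_zero_of_mulVec_eq_zero_of_adjugate_ne_zero hij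
      (v := A.adjugate i j • (fun l => A.adjugate l k) - A.adjugate i k • fun l => A.adjugate l j)
      (by rw [Matrix.mulVec_sub, Matrix.mulVec_smul, Matrix.mulVec_smul, hker, hker]; simp)
      (by simp [mul_comm])
    have := congrFun h l
    simpa [sub_eq_zero] using this
  refine ⟨A.adjugate i i / A.adjugate i j ^ 2, fun l => A.adjugate l j, ?_, hker j, ?_⟩
  · intro h
    exact hij (congrFun h i)
  · intro k l
    have h1 := hprop l k
    have h2 := hprop i l
    rw [hsymm l i] at h2
    field_simp
    linear_combination A.adjugate i j * h1 + A.adjugate k j * h2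

/-- Jacobi's formula for the derivative of a determinant. -/
theorem hasFDerivAt_det {F : Type*} [NormedAddCommGroup F] [NormedSpace ℝ F]
    {A : F → Matrix ι ι ℝ} {A' : ι → ι → F →L[ℝ] ℝ} {x : F}
    (h : ∀ i j, HasFDerivAt (fun y => A y i j) (A' i j) x) :
    HasFDerivAt (fun y => (A y).det) (∑ i, ∑ j, (A x).adjugate j i • A' i j) x := by
  have hA : HasFDerivAt (fun y => fun i j => A y i j)
      (ContinuousLinearMap.pi fun i => ContinuousLinearMap.pi fun j => A' i j) x :=
    hasFDerivAt_pi.2 fun i => hasFDerivAt_pi.2 fun j => h i j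
  -- The determinant as a multilinear function of the rows; its derivative replaces one row at a
  -- time.
  let D : ContinuousMultilinearMap ℝ (fun _ : ι => ι → ℝ) ℝ :=
    { (Matrix.detRowAlternating (n := ι) (R := ℝ)).toMultilinearMap with
      cont := by
        show Continuous fun B : ι → ι → ℝ => (Matrix.of B).det
        exact Continuous.matrix_det continuous_id }
  have hD : HasFDerivAt (fun y => D fun i j => A y i j) _ x :=
    (D.hasFDerivAt (fun i j => A x i j)).comp x hA
  refine hD.congr_fderiv ?_
  ext v
  simp only [ContinuousLinearMap.comp_apply, ContinuousMultilinearMap.linearDeriv_apply,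
    sum_apply, smul_apply, smul_eq_mul]
  refine Finset.sum_congr rfl fun i _ => ?_
  have : D (Function.update (fun i j => A x i j) i fun j => A' i j v)
      = ((A x).updateRow i fun j => A' i j v).det := rfl
  refine this.trans ?_
  rw [← Matrix.cramer_transpose_apply, Matrix.cramer_eq_adjugate_mulVec, ← Matrix.adjugate_transpose]
  simp [Matrix.mulVec, dotProduct]

end LinearAlgebra

/-! ### Christoffel symbols as smooth bilinear maps, with the denominator `det (g_ab)` split off. -/

section Local

variable {m : ℕ} {G : Model m → Model m →L[ℝ] Model m →L[ℝ] ℝ} {x : Model m}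

theorem sum_smul_stdVec (u : Model m) : ∑ i, u i • stdVec i = u := by
  ext j
  simp [stdVec, Finset.sum_apply, Pi.single_apply]

theorem gram_isSymm (hG : ∀ u v, G x u v = G x v u) : (gram G x).IsSymm :=
  Matrix.ext fun _ _ => hG _ _

theorem mulVec_gram (hG : ∀ u v, G x u v = G x v u) (u : Model m) (i : Fin m) :
    (gram G x).mulVec u.ofLp i = G x u (stdVec i) := by
  conv_rhs => rw [← sum_smul_stdVec u]
  simp [Matrix.mulVec, dotProduct, gram, mul_comm, hG]

theorem mulVec_gram_eq_zero_iff (hG : ∀ u v, G x u v = G x v u) (u : Model m) :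
    (gram G x).mulVec u.ofLp = 0 ↔ ∀ v, G x u v = 0 := by
  constructor
  · intro h v
    rw [← sum_smul_stdVec v]
    have : ∀ i, G x u (stdVec i) = 0 := fun i => by
      rw [← mulVec_gram hG, h]; rfl
    simp [this]
  · intro h
    ext i
    rw [mulVec_gram hG, h]; rfl

theorem det_gram_eq_zero_iff (hG : ∀ u v, G x u v = G x v u) :
    (gram G x).det = 0 ↔ ∃ u, u ≠ 0 ∧ ∀ v, G x u v = 0 := by
  rw [← Matrix.exists_mulVec_eq_zero_iff]
  constructor
  · rintro ⟨v, hv, h⟩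
    refine ⟨WithLp.toLp 2 v, by simpa using hv, ?_⟩
    rwa [← mulVec_gram_eq_zero_iff hG]
  · rintro ⟨u, hu, h⟩
    exact ⟨u.ofLp, by simpa using hu, (mulVec_gram_eq_zero_iff hG u).2 h⟩

/-- Christoffel symbols of the second kind multiplied by `det (g_ab)`. -/
def christoffelNum (G : Model m → Model m →L[ℝ] Model m →L[ℝ] ℝ) (x : Model m) :
    Model m →L[ℝ] Model m →L[ℝ] Model m :=
  (LinearMap.mk₂ ℝ (fun u v : Model m =>
    (WithLp.toLp 2 ((gram G x).adjugate.mulVec fun l => christoffelFirst G x u v (stdVec l)) :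
      Model m))
    (fun u u' v => by
      ext i
      simp only [christoffelFirst, Matrix.mulVec, dotProduct, map_add, PiLp.add_apply,
        add_apply, ← Finset.sum_add_distrib]
      exact Finset.sum_congr rfl fun _ _ => by ring)
    (fun c u v => by
      ext i
      simp only [christoffelFirst, Matrix.mulVec, dotProduct, map_smul, PiLp.smul_apply,
        smul_apply, smul_eq_mul, Finset.mul_sum]
      exact Finset.sum_congr rfl fun _ _ => by ring)
    (fun u v v' => by
      ext i
      simp only [christoffelFirst, Matrix.mulVec, dotProduct, map_add, PiLp.add_apply,
        add_apply, ← Finset.sum_add_distrib]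
      exact Finset.sum_congr rfl fun _ _ => by ring)
    (fun c u v => by
      ext i
      simp only [christoffelFirst, Matrix.mulVec, dotProduct, map_smul, PiLp.smul_apply,
        smul_apply, smul_eq_mul, Finset.mul_sum]
      exact Finset.sum_congr rfl fun _ _ => by ring)).toContinuousBilinearMap

theorem christoffelNum_apply (u v : Model m) :
    christoffelNum G x u v
      = WithLp.toLp 2 ((gram G x).adjugate.mulVec fun l => christoffelFirst G x u v (stdVec l)) :=
  rfl

/-- The Christoffel symbols of the second kind as a bilinear map. -/
def christoffelMap (G : Model m → Model m →L[ℝ] Model m →L[ℝ] ℝ) (x : Model m) :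
    Model m →L[ℝ] Model m →L[ℝ] Model m :=
  (gram G x).det⁻¹ • christoffelNum G x

theorem christoffelMap_apply (u v : Model m) : christoffelMap G x u v = christoffel G x u v := by
  simp only [christoffelMap, smul_apply, christoffelNum_apply, christoffel,
    Matrix.inv_def, Ring.inverse_eq_inv', Matrix.smul_mulVec]
  rfl

theorem contDiffAt_clm_of_stdVec {F W : Type*} [NormedAddCommGroup F] [NormedSpace ℝ F]
    [NormedAddCommGroup W] [NormedSpace ℝ W] {f : F → Model m →L[ℝ] W} {n : ℕ∞ω} {y : F}
    (h : ∀ a : Fin m, ContDiffAt ℝ n (fun z => f z (stdVec a)) y) : ContDiffAt ℝ n f y := by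
  have hf : f = fun z => ∑ a, ContinuousLinearMap.smulRightL ℝ (Model m) W
      (EuclideanSpace.proj a) (f z (stdVec a)) := by
    ext z u
    conv_lhs => rw [← sum_smul_stdVec u]
    simp [sum_apply]
  rw [hf]
  exact ContDiffAt.sum fun a _ => (ContinuousLinearMap.contDiff _).contDiffAt.comp y (h a)

theorem contDiffAt_gram {n : ℕ∞ω} (hG : ContDiffAt ℝ n G x) (i j : Fin m) :
    ContDiffAt ℝ n (fun y => gram G y i j) x :=
  (hG.clm_apply contDiffAt_const).clm_apply contDiffAt_const

theorem _root_.ContDiffAt.matrix_det {ι F : Type*} [Fintype ι] [DecidableEq ι]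
    [NormedAddCommGroup F] [NormedSpace ℝ F] {A : F → Matrix ι ι ℝ} {n : ℕ∞ω} {y : F}
    (h : ∀ i j, ContDiffAt ℝ n (fun z => A z i j) y) : ContDiffAt ℝ n (fun z => (A z).det) y := by
  simp only [Matrix.det_apply]
  exact ContDiffAt.sum fun σ _ => (contDiffAt_prod fun i _ => h _ _).const_smul _

theorem contDiffAt_det_gram {n : ℕ∞ω} (hG : ContDiffAt ℝ n G x) :
    ContDiffAt ℝ n (fun y => (gram G y).det) x :=
  ContDiffAt.matrix_det fun i j => contDiffAt_gram hG i j

theorem contDiffAt_adjugate_gram {n : ℕ∞ω} (hG : ContDiffAt ℝ n G x) (i j : Fin m) :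
    ContDiffAt ℝ n (fun y => (gram G y).adjugate i j) x := by
  simp only [Matrix.adjugate_apply]
  refine ContDiffAt.matrix_det fun k l => ?_
  by_cases hk : k = j
  · subst hk
    simpa using contDiffAt_const
  · simpa [Matrix.updateRow_ne hk] using contDiffAt_gram hG k l

theorem contDiffAt_christoffelNum (hG : ContDiffAt ℝ ∞ G x) :
    ContDiffAt ℝ ∞ (christoffelNum G) x := by
  refine contDiffAt_clm_of_stdVec fun a => contDiffAt_clm_of_stdVec fun b => ?_
  have hD : ContDiffAt ℝ ∞ (fderiv ℝ G) x := hG.fderiv_right (by simp)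
  have hD' : ∀ u v w, ContDiffAt ℝ ∞ (fun y => fderiv ℝ G y u v w) x := fun u v w =>
    ((hD.clm_apply contDiffAt_const).clm_apply contDiffAt_const).clm_apply contDiffAt_const
  rw [contDiffAt_piLp]
  intro i
  simp only [christoffelNum_apply, Matrix.mulVec, dotProduct, christoffelFirst]
  exact ContDiffAt.sum fun l _ => (contDiffAt_adjugate_gram hG i l).mul
    (contDiffAt_const.mul (((hD' _ _ _).add (hD' _ _ _)).sub (hD' _ _ _)))

theorem contDiffAt_christoffelMap (hG : ContDiffAt ℝ ∞ G x) (hdet : (gram G x).det ≠ 0) :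
    ContDiffAt ℝ ∞ (christoffelMap G) x :=
  ((contDiffAt_det_gram hG).inv hdet).smul (contDiffAt_christoffelNum hG)

theorem fderiv_apply₂ {C : Model m → Model m →L[ℝ] Model m →L[ℝ] Model m}
    (hC : DifferentiableAt ℝ C x) (u v w : Model m) :
    fderiv ℝ (fun y => C y v w) x u = fderiv ℝ C x u v w := by
  have := (hC.hasFDerivAt.clm_apply (hasFDerivAt_const v x)).clm_apply (hasFDerivAt_const w x)
  rw [this.fderiv]
  simp

/-- Differentiating the bundled bilinear map makes the dependence on `u`, `v`, `w` visibly linear.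
-/
theorem curvature_eq (hG : ContDiffAt ℝ ∞ G x) (hdet : (gram G x).det ≠ 0) (u v w : Model m) :
    curvature G x u v w = fderiv ℝ (christoffelMap G) x u v w - fderiv ℝ (christoffelMap G) x v u w
      + christoffelMap G x u (christoffelMap G x v w)
      - christoffelMap G x v (christoffelMap G x u w) := by
  have hC : DifferentiableAt ℝ (christoffelMap G) x :=
    (contDiffAt_christoffelMap hG hdet).differentiableAt (by simp)
  simp only [curvature, ← christoffelMap_apply, fderiv_apply₂ hC]

end Local

theorem two_le_infty : (2 : ℕ∞ω) ≤ ∞ :=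
  WithTop.coe_le_coe.2 (le_top : (2 : ℕ∞) ≤ ⊤)

/-! ### Invariance of curvature and Ricci curvature under local diffeomorphisms. -/

section Local

variable {m : ℕ} {G G' : Model m → Model m →L[ℝ] Model m →L[ℝ] ℝ} {x : Model m}
  {φ : Model m → Model m}

theorem hasFDerivAt_apply₂ {F V W : Type*} [NormedAddCommGroup F] [NormedSpace ℝ F]
    [NormedAddCommGroup V] [NormedSpace ℝ V] [NormedAddCommGroup W] [NormedSpace ℝ W]
    {B : F → V →L[ℝ] V →L[ℝ] W} {a b : F → V} {B' : F →L[ℝ] V →L[ℝ] V →L[ℝ] W}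
    {a' b' : F →L[ℝ] V} {y : F} (hB : HasFDerivAt B B' y) (ha : HasFDerivAt a a' y)
    (hb : HasFDerivAt b b' y) :
    HasFDerivAt (fun z => B z (a z) (b z))
      ((B y (a y)).comp b' + ((B'.flip (a y)) + (B y).comp a').flip (b y)) y := by
  refine ((hB.clm_apply ha).clm_apply hb).congr_fderiv ?_
  rw [add_comm (B'.flip (a y))]

theorem fderiv_form_symm (hG : DifferentiableAt ℝ G x) (hs : ∀ y u v, G y u v = G y v u)
    (w u v : Model m) : fderiv ℝ G x w u v = fderiv ℝ G x w v u := by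
  have h := fun u v => (hasFDerivAt_apply₂ hG.hasFDerivAt (hasFDerivAt_const u x)
    (hasFDerivAt_const v x))
  have h1 := h u v
  rw [show (fun z => G z u v) = fun z => G z v u from funext fun z => hs z u v] at h1
  have := congrArg (fun f => f w) (h1.unique (h v u))
  simpa using this

theorem christoffelFirst_symm (hG : DifferentiableAt ℝ G x) (hs : ∀ y u v, G y u v = G y v u)
    (u v w : Model m) : christoffelFirst G x u v w = christoffelFirst G x v u w := by
  simp only [christoffelFirst]
  rw [fderiv_form_symm hG hs u v w, fderiv_form_symm hG hs v w u, fderiv_form_symm hG hs w u v]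
  ring

theorem christoffelFirst_eq_sum (u v w : Model m) :
    christoffelFirst G x u v w = ∑ i, w i * christoffelFirst G x u v (stdVec i) := by
  conv_lhs => rw [← sum_smul_stdVec w]
  simp only [christoffelFirst, map_sum, map_smul, smul_eq_mul, sum_apply, smul_apply,
    ← Finset.sum_add_distrib, ← Finset.sum_sub_distrib, Finset.mul_sum]
  exact Finset.sum_congr rfl fun _ _ => by ring

/-- The Koszul formula. -/
theorem form_christoffelMap (hs : ∀ y u v, G y u v = G y v u) (hdet : (gram G x).det ≠ 0)
    (u v w : Model m) : G x (christoffelMap G x u v) w = christoffelFirst G x u v w := by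
  have h : ∀ i, G x (christoffelMap G x u v) (stdVec i) = christoffelFirst G x u v (stdVec i) := by
    intro i
    rw [← mulVec_gram (hs x), christoffelMap_apply, christoffel, Matrix.mulVec_mulVec,
      Matrix.mul_nonsing_inv _ (isUnit_iff_ne_zero.2 hdet), Matrix.one_mulVec]
  rw [christoffelFirst_eq_sum u v w]
  conv_lhs => rw [← sum_smul_stdVec w]
  simp [h]

theorem eq_of_forall_form_eq (hs : ∀ y u v, G y u v = G y v u) (hdet : (gram G x).det ≠ 0)
    {u v : Model m} (h : ∀ w, G x u w = G x v w) : u = v := by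
  by_contra huv
  exact hdet ((det_gram_eq_zero_iff (hs x)).2 ⟨u - v, sub_ne_zero.2 huv, fun w => by simp [h]⟩)

/-- `G'` is the pullback of `G` under `φ` near `x`. -/
structure IsLocalPullback (φ : Model m → Model m)
    (G' G : Model m → Model m →L[ℝ] Model m →L[ℝ] ℝ) (x : Model m) : Prop where
  eventually_smooth_map : ∀ᶠ y in 𝓝 x, ContDiffAt ℝ ∞ φ y
  eventually_smooth_form : ∀ᶠ y in 𝓝 (φ x), ContDiffAt ℝ ∞ G y
  eventually_smooth_form' : ∀ᶠ y in 𝓝 x, ContDiffAt ℝ ∞ G' y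
  bijective : Function.Bijective (fderiv ℝ φ x)
  eq : ∀ᶠ y in 𝓝 x, ∀ u v, G' y u v = G (φ y) (fderiv ℝ φ y u) (fderiv ℝ φ y v)

variable (h : IsLocalPullback φ G' G x)

include h

theorem IsLocalPullback.smooth_map : ContDiffAt ℝ ∞ φ x := h.eventually_smooth_map.self_of_nhds

theorem IsLocalPullback.smooth_form : ContDiffAt ℝ ∞ G (φ x) :=
  h.eventually_smooth_form.self_of_nhds

theorem IsLocalPullback.smooth_form' : ContDiffAt ℝ ∞ G' x :=
  h.eventually_smooth_form'.self_of_nhds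

theorem IsLocalPullback.det_ne_zero (hs : ∀ y u v, G y u v = G y v u)
    (hs' : ∀ y u v, G' y u v = G' y v u) (hdet : (gram G (φ x)).det ≠ 0) :
    (gram G' x).det ≠ 0 := by
  intro h0
  obtain ⟨u, hu, huv⟩ := (det_gram_eq_zero_iff (hs' x)).1 h0
  refine hdet ((det_gram_eq_zero_iff (hs (φ x))).2 ⟨fderiv ℝ φ x u, ?_, fun v => ?_⟩)
  · intro h1
    exact hu (h.bijective.1 (by rw [h1, map_zero]))
  · obtain ⟨v, rfl⟩ := h.bijective.2 v
    rw [← h.eq.self_of_nhds, huv]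

theorem IsLocalPullback.fderiv_eq (u v w : Model m) :
    fderiv ℝ G' x u v w
      = fderiv ℝ G (φ x) (fderiv ℝ φ x u) (fderiv ℝ φ x v) (fderiv ℝ φ x w)
        + G (φ x) (fderiv ℝ (fderiv ℝ φ) x u v) (fderiv ℝ φ x w)
        + G (φ x) (fderiv ℝ φ x v) (fderiv ℝ (fderiv ℝ φ) x u w) := by
  have hφ : HasFDerivAt φ (fderiv ℝ φ x) x :=
    (h.smooth_map.differentiableAt (by simp)).hasFDerivAt
  have hφ' : HasFDerivAt (fderiv ℝ φ) (fderiv ℝ (fderiv ℝ φ) x) x :=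
    ((h.smooth_map.fderiv_right (m := ∞) (by simp)).differentiableAt (by simp)).hasFDerivAt
  have hG : HasFDerivAt (fun y => G (φ y)) ((fderiv ℝ G (φ x)).comp (fderiv ℝ φ x)) x :=
    ((h.smooth_form.differentiableAt (by simp)).hasFDerivAt).comp x hφ
  have hG' : HasFDerivAt G' (fderiv ℝ G' x) x :=
    (h.smooth_form'.differentiableAt (by simp)).hasFDerivAt
  have h1 := hasFDerivAt_apply₂ hG' (hasFDerivAt_const v x) (hasFDerivAt_const w x)
  have h2 := hasFDerivAt_apply₂ hG (hφ'.clm_apply (hasFDerivAt_const v x))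
    (hφ'.clm_apply (hasFDerivAt_const w x))
  have h3 := h1.unique (h2.congr_of_eventuallyEq (h.eq.mono fun y hy => hy v w))
  have := congrArg (fun f => f u) h3
  simp at this
  rw [this]
  ring

/-- Every clause is an open condition, so identities proved at `x` hold nearby and can be
differentiated. -/
theorem IsLocalPullback.eventually : ∀ᶠ y in 𝓝 x, IsLocalPullback φ G' G y := by
  have hdet : ContinuousAt (fun y => (fderiv ℝ φ y).det) x :=
    ContinuousLinearMap.continuous_det.continuousAt.comp
      (h.smooth_map.fderiv_right (m := ∞) (by simp)).continuousAt
  have hbij : ∀ T : Model m →L[ℝ] Model m, Function.Bijective T ↔ T.det ≠ 0 := by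
    intro T
    rw [← isUnit_iff_ne_zero, ContinuousLinearMap.det, ← LinearMap.isUnit_iff_isUnit_det,
      Module.End.isUnit_iff]
    rfl
  filter_upwards [eventually_eventually_nhds.2 h.eventually_smooth_map,
    eventually_eventually_nhds.2 h.eventually_smooth_form',
    h.smooth_map.continuousAt.eventually (eventually_eventually_nhds.2 h.eventually_smooth_form),
    eventually_eventually_nhds.2 h.eq,
    hdet.eventually_ne ((hbij _).1 h.bijective)] with y h1 h2 h3 h4 h5
  exact ⟨h1, h3, h2, (hbij _).2 h5, h4⟩

theorem IsLocalPullback.fderiv_fderiv_symm (u v : Model m) :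
    fderiv ℝ (fderiv ℝ φ) x u v = fderiv ℝ (fderiv ℝ φ) x v u :=
  (h.smooth_map.isSymmSndFDerivAt (by simpa using two_le_infty)) u v

/-- Test against image vectors and use Koszul: of the six terms containing `D²φ`, four cancel by
symmetry of `D²φ` and `G`, and the other two coincide. -/
theorem IsLocalPullback.map_christoffelMap (hs : ∀ y u v, G y u v = G y v u)
    (hs' : ∀ y u v, G' y u v = G' y v u) (hdet : (gram G (φ x)).det ≠ 0) (u v : Model m) :
    fderiv ℝ φ x (christoffelMap G' x u v) = fderiv ℝ (fderiv ℝ φ) x u v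
      + christoffelMap G (φ x) (fderiv ℝ φ x u) (fderiv ℝ φ x v) := by
  refine eq_of_forall_form_eq hs hdet fun w => ?_
  obtain ⟨w, rfl⟩ := h.bijective.2 w
  rw [← h.eq.self_of_nhds, form_christoffelMap hs' (h.det_ne_zero hs hs' hdet), map_add,
    add_apply, form_christoffelMap hs hdet, christoffelFirst, christoffelFirst,
    h.fderiv_eq, h.fderiv_eq, h.fderiv_eq, h.fderiv_fderiv_symm v u, h.fderiv_fderiv_symm w u,
    h.fderiv_fderiv_symm w v, hs (φ x) (fderiv ℝ φ x w), hs (φ x) (fderiv ℝ φ x u),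
    hs (φ x) (fderiv ℝ φ x v)]
  ring

theorem IsLocalPullback.map_fderiv_christoffelMap (hs : ∀ y u v, G y u v = G y v u)
    (hs' : ∀ y u v, G' y u v = G' y v u) (hdet : (gram G (φ x)).det ≠ 0) (u v w : Model m) :
    fderiv ℝ φ x (fderiv ℝ (christoffelMap G') x u v w)
      + fderiv ℝ (fderiv ℝ φ) x u (christoffelMap G' x v w)
      = fderiv ℝ (fderiv ℝ (fderiv ℝ φ)) x u v w
        + (fderiv ℝ (christoffelMap G) (φ x) (fderiv ℝ φ x u) (fderiv ℝ φ x v) (fderiv ℝ φ x w)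
        + christoffelMap G (φ x) (fderiv ℝ (fderiv ℝ φ) x u v) (fderiv ℝ φ x w)
        + christoffelMap G (φ x) (fderiv ℝ φ x v) (fderiv ℝ (fderiv ℝ φ) x u w)) := by
  have hφ : HasFDerivAt φ (fderiv ℝ φ x) x :=
    (h.smooth_map.differentiableAt (by simp)).hasFDerivAt
  have sφ' : ContDiffAt ℝ ∞ (fderiv ℝ φ) x := h.smooth_map.fderiv_right (by simp)
  have hφ' : HasFDerivAt (fderiv ℝ φ) (fderiv ℝ (fderiv ℝ φ) x) x :=
    (sφ'.differentiableAt (by simp)).hasFDerivAt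
  have hφ'' : HasFDerivAt (fderiv ℝ (fderiv ℝ φ)) (fderiv ℝ (fderiv ℝ (fderiv ℝ φ)) x) x :=
    ((sφ'.fderiv_right (m := ∞) (by simp)).differentiableAt (by simp)).hasFDerivAt
  have hC : HasFDerivAt (fun y => christoffelMap G (φ y))
      ((fderiv ℝ (christoffelMap G) (φ x)).comp (fderiv ℝ φ x)) x :=
    (((contDiffAt_christoffelMap h.smooth_form hdet).differentiableAt
      (by simp)).hasFDerivAt).comp x hφ
  have hC' : HasFDerivAt (christoffelMap G') (fderiv ℝ (christoffelMap G') x) x :=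
    ((contDiffAt_christoffelMap h.smooth_form' (h.det_ne_zero hs hs' hdet)).differentiableAt
      (by simp)).hasFDerivAt
  have h1 := hφ'.clm_apply
    (hasFDerivAt_apply₂ hC' (hasFDerivAt_const v x) (hasFDerivAt_const w x))
  have h2 := (hasFDerivAt_apply₂ hφ'' (hasFDerivAt_const v x) (hasFDerivAt_const w x)).add
    (hasFDerivAt_apply₂ hC (hφ'.clm_apply (hasFDerivAt_const v x))
      (hφ'.clm_apply (hasFDerivAt_const w x)))
  have hne : ∀ᶠ y in 𝓝 x, (gram G (φ y)).det ≠ 0 :=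
    h.smooth_map.continuousAt.eventually
      ((contDiffAt_det_gram h.smooth_form).continuousAt.eventually_ne hdet)
  have h3 := h1.unique (h2.congr_of_eventuallyEq (by
    filter_upwards [hne, h.eventually] with y hy hy'
    exact hy'.map_christoffelMap hs hs' hy v w))
  have := congrArg (fun f => f u) h3
  simp at this
  rw [this]
  abel

/-- Antisymmetrize the differentiated transformation law in `u`, `v`: the third derivatives of `φ`
drop out by symmetry, and the second derivatives cancel against the inhomogeneous terms in the
products of Christoffel symbols. -/
theorem IsLocalPullback.map_curvature (hs : ∀ y u v, G y u v = G y v u)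
    (hs' : ∀ y u v, G' y u v = G' y v u) (hdet : (gram G (φ x)).det ≠ 0) (u v w : Model m) :
    fderiv ℝ φ x (curvature G' x u v w)
      = curvature G (φ x) (fderiv ℝ φ x u) (fderiv ℝ φ x v) (fderiv ℝ φ x w) := by
  have sφ' : ContDiffAt ℝ ∞ (fderiv ℝ φ) x := h.smooth_map.fderiv_right (by simp)
  have hS : fderiv ℝ (fderiv ℝ (fderiv ℝ φ)) x u v w = fderiv ℝ (fderiv ℝ (fderiv ℝ φ)) x v u w :=
    congrArg (fun f => f w) ((sφ'.isSymmSndFDerivAt (by simpa using two_le_infty)) u v)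
  have h1 := h.map_fderiv_christoffelMap hs hs' hdet u v w
  have h2 := h.map_fderiv_christoffelMap hs hs' hdet v u w
  rw [curvature_eq h.smooth_form' (h.det_ne_zero hs hs' hdet), curvature_eq h.smooth_form hdet,
    map_sub, map_add, map_sub, eq_sub_of_add_eq h1, eq_sub_of_add_eq h2,
    h.map_christoffelMap hs hs' hdet u (christoffelMap G' x v w),
    h.map_christoffelMap hs hs' hdet v (christoffelMap G' x u w),
    h.map_christoffelMap hs hs' hdet v w, h.map_christoffelMap hs hs' hdet u w, hS,
    h.fderiv_fderiv_symm v u, map_add, map_add]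
  abel

omit h

/-- The endomorphism `a ↦ R(u,a)v` whose trace is the Ricci curvature, at regular points. -/
def curvatureEnd (G : Model m → Model m →L[ℝ] Model m →L[ℝ] ℝ) (x u v : Model m) :
    Model m →ₗ[ℝ] Model m where
  -- Written with bundled maps, so that linearity in `a` needs no regularity at `x`.
  toFun a := fderiv ℝ (christoffelMap G) x u a v - fderiv ℝ (christoffelMap G) x a u v
      + christoffelMap G x u (christoffelMap G x a v)
      - christoffelMap G x a (christoffelMap G x u v)
  map_add' a b := by simp only [map_add, add_apply]; abel
  map_smul' c a := by
    simp only [map_smul, smul_apply, RingHom.id_apply, smul_sub, smul_add]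

theorem ricciLocal_eq_trace (hG : ContDiffAt ℝ ∞ G x) (hdet : (gram G x).det ≠ 0)
    (u v : Model m) : ricciLocal G x u v = LinearMap.trace ℝ _ (curvatureEnd G x u v) := by
  rw [LinearMap.trace_eq_matrix_trace ℝ (EuclideanSpace.basisFun (Fin m) ℝ).toBasis]
  simp only [ricciLocal, curvature_eq hG hdet, Matrix.trace, Matrix.diag, LinearMap.toMatrix_apply]
  refine Finset.sum_congr rfl fun i _ => ?_
  simp [curvatureEnd, stdVec]

include h in
/-- The Ricci curvature is invariant under diffeomorphisms. -/
theorem IsLocalPullback.ricciLocal_eq (hs : ∀ y u v, G y u v = G y v u)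
    (hs' : ∀ y u v, G' y u v = G' y v u) (hdet : (gram G (φ x)).det ≠ 0) (u v : Model m) :
    ricciLocal G' x u v = ricciLocal G (φ x) (fderiv ℝ φ x u) (fderiv ℝ φ x v) := by
  have hdet' := h.det_ne_zero hs hs' hdet
  rw [ricciLocal_eq_trace h.smooth_form' hdet', ricciLocal_eq_trace h.smooth_form hdet]
  let P : Model m ≃ₗ[ℝ] Model m := LinearEquiv.ofBijective (fderiv ℝ φ x).toLinearMap h.bijective
  rw [← LinearMap.trace_conj' (curvatureEnd G' x u v) P]
  congr 1
  ext a : 1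
  obtain ⟨a, rfl⟩ := P.surjective a
  have h1 := h.map_curvature hs hs' hdet u a v
  rw [curvature_eq h.smooth_form' hdet', curvature_eq h.smooth_form hdet] at h1
  simpa [LinearEquiv.conj_apply, curvatureEnd] using! h1

theorem ricciLocal_add_left (hG : ContDiffAt ℝ ∞ G x) (hdet : (gram G x).det ≠ 0)
    (u u' v : Model m) : ricciLocal G x (u + u') v = ricciLocal G x u v + ricciLocal G x u' v := by
  simp only [ricciLocal_eq_trace hG hdet, ← map_add]
  congr 1
  ext a : 1
  simp only [curvatureEnd, LinearMap.coe_mk, AddHom.coe_mk, LinearMap.add_apply, map_add, add_apply]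
  abel

theorem ricciLocal_add_right (hG : ContDiffAt ℝ ∞ G x) (hdet : (gram G x).det ≠ 0)
    (u v v' : Model m) : ricciLocal G x u (v + v') = ricciLocal G x u v + ricciLocal G x u v' := by
  simp only [ricciLocal_eq_trace hG hdet, ← map_add]
  congr 1
  ext a : 1
  simp only [curvatureEnd, LinearMap.coe_mk, AddHom.coe_mk, LinearMap.add_apply, map_add]
  abel

theorem ricciLocal_smul_smul (hG : ContDiffAt ℝ ∞ G x) (hdet : (gram G x).det ≠ 0)
    (c : ℝ) (u v : Model m) : ricciLocal G x (c • u) (c • v) = c ^ 2 * ricciLocal G x u v := by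
  simp only [ricciLocal_eq_trace hG hdet, ← smul_eq_mul, ← map_smul]
  congr 1
  ext a : 1
  simp only [curvatureEnd, LinearMap.coe_mk, AddHom.coe_mk, LinearMap.smul_apply, map_smul,
    smul_apply, smul_sub, smul_add, smul_smul, pow_two]

end Local

/-! ### The behaviour of `det² Ric` at a singular point. -/

section Local

variable {m : ℕ} {G : Model m → Model m →L[ℝ] Model m →L[ℝ] ℝ} {x : Model m}

/-- The product rule applied to `det • christoffelMap = christoffelNum`, multiplied once more by
`det` to clear the remaining denominator. -/
theorem fderiv_christoffelMap (hG : ContDiffAt ℝ ∞ G x) (hdet : (gram G x).det ≠ 0)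
    (u v w : Model m) :
    (gram G x).det ^ 2 • fderiv ℝ (christoffelMap G) x u v w
      = (gram G x).det • fderiv ℝ (christoffelNum G) x u v w
        - fderiv ℝ (fun y => (gram G y).det) x u • christoffelNum G x v w := by
  have hd : HasFDerivAt (fun y => (gram G y).det) (fderiv ℝ (fun y => (gram G y).det) x) x :=
    ((contDiffAt_det_gram hG).differentiableAt (by simp)).hasFDerivAt
  have hK : HasFDerivAt (christoffelNum G) (fderiv ℝ (christoffelNum G) x) x :=
    ((contDiffAt_christoffelNum hG).differentiableAt (by simp)).hasFDerivAt
  have hC : HasFDerivAt (christoffelMap G) (fderiv ℝ (christoffelMap G) x) x :=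
    ((contDiffAt_christoffelMap hG hdet).differentiableAt (by simp)).hasFDerivAt
  have hne := (contDiffAt_det_gram hG).continuousAt.eventually_ne hdet
  have h := (hd.smul hC).unique (hK.congr_of_eventuallyEq (by
    filter_upwards [hne] with y hy
    simp [christoffelMap, smul_smul, hy]))
  have h' := congrArg (fun f => f u v w) h
  simp only [add_apply, smul_apply, ContinuousLinearMap.smulRight_apply] at h'
  rw [← h', pow_two, smul_add, smul_smul, christoffelMap, smul_apply, smul_apply, smul_comm,
    smul_smul _ _ (christoffelNum G x v w), smul_smul _ _ (christoffelNum G x v w)]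
  field_simp
  simp

/-- `det² Ric`, expressed through quantities that remain smooth where `det` vanishes. -/
def ricciNum (G : Model m → Model m →L[ℝ] Model m →L[ℝ] ℝ) (w x : Model m) : ℝ :=
  ∑ i, ((gram G x).det * fderiv ℝ (christoffelNum G) x w (stdVec i) w i
    - fderiv ℝ (fun y => (gram G y).det) x w * christoffelNum G x (stdVec i) w i
    - ((gram G x).det * fderiv ℝ (christoffelNum G) x (stdVec i) w w i
      - fderiv ℝ (fun y => (gram G y).det) x (stdVec i) * christoffelNum G x w w i)
    + christoffelNum G x w (christoffelNum G x (stdVec i) w) i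
    - christoffelNum G x (stdVec i) (christoffelNum G x w w) i)

theorem sq_det_mul_ricciLocal (hG : ContDiffAt ℝ ∞ G x) (hdet : (gram G x).det ≠ 0)
    (w : Model m) : (gram G x).det ^ 2 * ricciLocal G x w w = ricciNum G w x := by
  simp only [ricciLocal, ricciNum, Finset.mul_sum]
  refine Finset.sum_congr rfl fun i _ => ?_
  have h1 := congrArg (fun f : Model m => f i) (fderiv_christoffelMap hG hdet w (stdVec i) w)
  have h2 := congrArg (fun f : Model m => f i) (fderiv_christoffelMap hG hdet (stdVec i) w w)
  simp only [PiLp.smul_apply, PiLp.sub_apply, smul_eq_mul] at h1 h2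
  rw [curvature_eq hG hdet, PiLp.sub_apply, PiLp.add_apply, PiLp.sub_apply, ← h1, ← h2]
  simp only [christoffelMap, smul_apply, map_smul, PiLp.smul_apply, smul_eq_mul]
  field_simp

/-- No nondegeneracy is needed, so this yields the limit of `det² Ric(w,w)` at points of `Σ`. -/
theorem continuousAt_ricciNum (hG : ContDiffAt ℝ ∞ G x) (w : Model m) :
    ContinuousAt (ricciNum G w) x := by
  have hd := contDiffAt_det_gram hG
  have hK := contDiffAt_christoffelNum hG
  have hd' : ∀ u, ContinuousAt (fun y => fderiv ℝ (fun y => (gram G y).det) y u) x := fun u =>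
    (hd.fderiv_right (m := ∞) (by simp)).continuousAt.clm_apply continuousAt_const
  have hK' : ∀ u v w, ContinuousAt (fun y => fderiv ℝ (christoffelNum G) y u v w) x :=
    fun u v w => (((hK.fderiv_right (m := ∞) (by simp)).continuousAt.clm_apply
      continuousAt_const).clm_apply continuousAt_const).clm_apply continuousAt_const
  have hKc : ∀ {u v : Model m → Model m}, ContinuousAt u x → ContinuousAt v x →
      ContinuousAt (fun y => christoffelNum G y (u y) (v y)) x := fun hu hv =>
    (hK.continuousAt.clm_apply hu).clm_apply hv
  have hp : ∀ {u : Model m → Model m} (i : Fin m), ContinuousAt u x →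
      ContinuousAt (fun y => u y i) x := fun i hu =>
    (EuclideanSpace.proj (𝕜 := ℝ) i).continuous.continuousAt.comp hu
  have hc : ∀ u : Model m, ContinuousAt (fun _ : Model m => u) x := fun _ => continuousAt_const
  unfold ricciNum
  refine tendsto_finsetSum _ fun i _ => ?_
  exact ((((hd.continuousAt.mul (hp i (hK' _ _ _))).sub
    ((hd' _).mul (hp i (hKc (hc _) (hc _))))).sub
    ((hd.continuousAt.mul (hp i (hK' _ _ _))).sub
    ((hd' _).mul (hp i (hKc (hc _) (hc _)))))).add
    (hp i (hKc (hc _) (hKc (hc _) (hc _))))).sub (hp i (hKc (hc _) (hKc (hc _) (hc _))))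

theorem sum_mul_christoffelFirst (u v R : Model m) :
    ∑ i, R i * christoffelFirst G x (stdVec i) u v = christoffelFirst G x R u v := by
  conv_rhs => rw [← sum_smul_stdVec R]
  simp only [christoffelFirst, map_sum, map_smul, smul_eq_mul, sum_apply, smul_apply,
    ← Finset.sum_add_distrib, ← Finset.sum_sub_distrib, Finset.mul_sum]
  exact Finset.sum_congr rfl fun _ _ => by ring

theorem fderiv_det_gram (hG : DifferentiableAt ℝ G x) (v : Model m) :
    fderiv ℝ (fun y => (gram G y).det) x v
      = ∑ i, ∑ j, (gram G x).adjugate j i * fderiv ℝ G x v (stdVec i) (stdVec j) := by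
  have h : ∀ i j, HasFDerivAt (fun y => gram G y i j) _ x := fun i j =>
    hasFDerivAt_apply₂ hG.hasFDerivAt (hasFDerivAt_const (stdVec i) x)
      (hasFDerivAt_const (stdVec j) x)
  rw [(hasFDerivAt_det h).fderiv]
  simp [sum_apply]

/-- At a transverse singular point with tangent radical, `det² Ric(w,w)` has the value
`-(d det(w))² / 4`. -/
theorem ricciNum_eq (hG : ContDiffAt ℝ ∞ G x) (hs : ∀ y u v, G y u v = G y v u)
    (hdet : (gram G x).det = 0) (hd : fderiv ℝ (fun y => (gram G y).det) x ≠ 0)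
    (hR : ∀ R, (∀ v, G x R v = 0) → fderiv ℝ (fun y => (gram G y).det) x R = 0) (w : Model m) :
    ricciNum G w x = -(fderiv ℝ (fun y => (gram G y).det) x w) ^ 2 / 4 := by
  have hG' : DifferentiableAt ℝ G x := hG.differentiableAt (by simp)
  -- By Jacobi's formula a zero adjugate would force `d det = 0`.
  have hadj : (gram G x).adjugate ≠ 0 := by
    intro h0
    refine hd (ContinuousLinearMap.ext fun v => ?_)
    simp [fderiv_det_gram hG', h0]
  obtain ⟨c, R₀, -, hR₀, hc⟩ := exists_adjugate_eq_smul_vecMulVec (gram_isSymm (hs x)) hdet hadj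
  obtain ⟨R, rfl⟩ : ∃ R : Model m, R.ofLp = R₀ := ⟨WithLp.toLp 2 R₀, rfl⟩
  have hdR := hR R ((mulVec_gram_eq_zero_iff (hs x) R).1 hR₀)
  have hfd : ∀ v, fderiv ℝ (fun y => (gram G y).det) x v = c * fderiv ℝ G x v R R := by
    intro v
    have h1 : fderiv ℝ G x v R R = ∑ i, ∑ j, R i * R j * fderiv ℝ G x v (stdVec i) (stdVec j) := by
      conv_lhs => rw [← sum_smul_stdVec R]
      simp only [map_sum, map_smul, smul_eq_mul, sum_apply, smul_apply, Finset.mul_sum, mul_assoc]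
      rw [Finset.sum_comm]
      exact Finset.sum_congr rfl fun _ _ => Finset.sum_congr rfl fun _ _ => by ring
    rw [fderiv_det_gram hG', h1]
    simp only [Finset.mul_sum, hc]
    exact Finset.sum_congr rfl fun _ _ => Finset.sum_congr rfl fun _ _ => by ring
  have hQ : ∀ v, c * christoffelFirst G x v R R
      = fderiv ℝ (fun y => (gram G y).det) x v / 2 := by
    intro v
    rw [hfd, christoffelFirst, fderiv_form_symm hG' hs R v R]
    ring
  -- Raising the index with `c R Rᵀ` leaves only the radical direction.
  have hK : ∀ u v, christoffelNum G x u v = (c * christoffelFirst G x u v R) • R := by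
    intro u v
    ext i
    rw [christoffelNum_apply, christoffelFirst_eq_sum u v R]
    simp only [Matrix.mulVec, dotProduct, hc, PiLp.smul_apply, smul_eq_mul, Finset.mul_sum,
      Finset.sum_mul]
    exact Finset.sum_congr rfl fun _ _ => by ring
  have hsum : fderiv ℝ (fun y => (gram G y).det) x R
      = ∑ i, R i * fderiv ℝ (fun y => (gram G y).det) x (stdVec i) := by
    conv_lhs => rw [← sum_smul_stdVec R]
    simp only [map_sum, map_smul, smul_eq_mul]
  have hsm : ∀ a u v w, christoffelFirst G x u (a • v) w = a * christoffelFirst G x u v w := by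
    intro a u v w
    simp only [christoffelFirst, map_smul, smul_apply, smul_eq_mul]
    ring
  -- The terms carrying a factor `det`, including all derivatives of `christoffelNum`, vanish here.
  have hterm : ricciNum G w x
      = - fderiv ℝ (fun y => (gram G y).det) x w * c * christoffelFirst G x R w R
        + fderiv ℝ (fun y => (gram G y).det) x R * c * christoffelFirst G x w w R
        + c ^ 2 * christoffelFirst G x w R R * christoffelFirst G x R w R
        - c ^ 2 * christoffelFirst G x w w R * christoffelFirst G x R R R := by
    rw [← sum_mul_christoffelFirst w R R, ← sum_mul_christoffelFirst R R R, hsum]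
    simp only [ricciNum, hK, hdet, hsm, PiLp.smul_apply, smul_eq_mul, Finset.mul_sum,
      Finset.sum_mul, ← Finset.sum_add_distrib, ← Finset.sum_sub_distrib]
    exact Finset.sum_congr rfl fun _ _ => by ring
  have h1 := hQ R
  have h2 := hQ w
  rw [hterm, christoffelFirst_symm hG' hs R w R, hdR]
  rw [hdR] at h1
  linear_combination (-(fderiv ℝ (fun y => (gram G y).det) x w)
    + c * christoffelFirst G x w R R + fderiv ℝ (fun y => (gram G y).det) x w / 2) * h2
    - c * christoffelFirst G x w w R * h1

end Local

/-! ### Coordinate expressions of `g` and independence of the chart. -/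

section Manifold

variable {m : ℕ} {M : Type*} [TopologicalSpace M] [ChartedSpace (Model m) M]
  [IsManifold (𝓡 m) ∞ M] {g : SymmTensor m M} {e e' : OpenPartialHomeomorph M (Model m)} {p : M}

/-- The derivative of a chart, read in the model space. -/
def chartDeriv (e : OpenPartialHomeomorph M (Model m)) (p : M) : Model m →L[ℝ] Model m :=
  mfderiv (𝓡 m) (𝓡 m) e p

/-- The derivative of the inverse of a chart, read in the model space. -/
def chartSymmDeriv (e : OpenPartialHomeomorph M (Model m)) (x : Model m) :
    Model m →L[ℝ] Model m :=
  mfderiv (𝓡 m) (𝓡 m) e.symm x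

/-- The bilinear form of `g` at `p`, read in the model space. -/
def modelForm (g : SymmTensor m M) (p : M) : Model m →L[ℝ] Model m →L[ℝ] ℝ :=
  g.form p

theorem chartMetric_apply (x u v : Model m) : chartMetric g e x u v
    = modelForm g (e.symm x) (chartSymmDeriv e x u) (chartSymmDeriv e x v) :=
  rfl

theorem chartMetric_symm (x u v : Model m) : chartMetric g e x u v = chartMetric g e x v u :=
  g.symm _ _ _

omit [IsManifold (𝓡 m) ∞ M] in
theorem mDifferentiable_of_mem_maximalAtlas (he : e ∈ IsManifold.maximalAtlas (𝓡 m) ∞ M) :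
    e.MDifferentiable (𝓡 m) (𝓡 m) :=
  ⟨fun _ hx => ((contMDiffAt_of_mem_maximalAtlas he hx).mdifferentiableAt
      (by simp)).mdifferentiableWithinAt,
    fun _ hx => ((contMDiffAt_symm_of_mem_maximalAtlas he hx).mdifferentiableAt
      (by simp)).mdifferentiableWithinAt⟩

omit [IsManifold (𝓡 m) ∞ M] in
theorem chartSymmDeriv_chartDeriv (he : e ∈ IsManifold.maximalAtlas (𝓡 m) ∞ M)
    (hp : p ∈ e.source) (v : Model m) : chartSymmDeriv e (e p) (chartDeriv e p v) = v :=
  congrArg (fun f => f v) ((mDifferentiable_of_mem_maximalAtlas he).symm_comp_deriv hp)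

omit [IsManifold (𝓡 m) ∞ M] in
theorem chartDeriv_chartSymmDeriv (he : e ∈ IsManifold.maximalAtlas (𝓡 m) ∞ M)
    (hp : p ∈ e.source) (v : Model m) : chartDeriv e p (chartSymmDeriv e (e p) v) = v := by
  have h := congrArg (fun f => f v)
    ((mDifferentiable_of_mem_maximalAtlas he).comp_symm_deriv (e.map_source hp))
  have h' : chartDeriv e (e.symm (e p)) (chartSymmDeriv e (e p) v) = v := h
  rwa [e.left_inv hp] at h'

/-- A coordinate field is the tangent map of `e.symm` along a constant section. -/
theorem contMDiffAt_chartSymmDeriv (he : e ∈ IsManifold.maximalAtlas (𝓡 m) ∞ M) {x : Model m}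
    (hx : x ∈ e.target) (a : Model m) :
    ContMDiffAt (𝓡 m) (𝓡 m).tangent ∞
      (fun y => (⟨e.symm y, chartSymmDeriv e y a⟩ : TangentBundle (𝓡 m) M)) x := by
  have h1 := (contMDiffOn_symm_of_mem_maximalAtlas he).contMDiffOn_tangentMapWithin
    (m := ∞) (by simp) e.open_target.uniqueMDiffOn
  have h2 : ContMDiffAt (𝓡 m) (𝓡 m).tangent ∞
      (fun y => (⟨y, a⟩ : TangentBundle (𝓡 m) (Model m))) x :=
    contMDiffAt_vectorSpace_iff_contDiffAt.2 contDiffAt_const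
  have h3 := (h1 ⟨x, a⟩ hx).contMDiffAt
    (((FiberBundle.continuous_proj _ _).isOpen_preimage _ e.open_target).mem_nhds hx)
  refine (h3.comp x h2).congr_of_eventuallyEq ?_
  filter_upwards [e.open_target.mem_nhds hx] with y hy
  simp only [Function.comp_apply, tangentMapWithin, chartSymmDeriv,
    mfderivWithin_of_isOpen e.open_target hy]
  rfl

theorem contDiffAt_chartMetric (g : SymmTensor m M)
    (he : e ∈ IsManifold.maximalAtlas (𝓡 m) ∞ M) {x : Model m} (hx : x ∈ e.target) :
    ContDiffAt ℝ ∞ (chartMetric g e) x := by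
  refine contDiffAt_clm_of_stdVec fun a => contDiffAt_clm_of_stdVec fun b => ?_
  have h : ContMDiffAt (𝓡 m) ((𝓡 m).prod 𝓘(ℝ)) ∞
      (fun y => Bundle.TotalSpace.mk' ℝ (E := Bundle.Trivial M ℝ) (e.symm y)
        (g.form (e.symm y) (chartSymmDeriv e y (stdVec a)) (chartSymmDeriv e y (stdVec b)))) x := by
    apply ContMDiffAt.clm_bundle_apply₂ (F₁ := Model m) (F₂ := Model m)
    · exact g.smooth.contMDiffAt.comp x (contMDiffAt_symm_of_mem_maximalAtlas he hx)
    · exact contMDiffAt_chartSymmDeriv he hx _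
    · exact contMDiffAt_chartSymmDeriv he hx _
  rw [Bundle.contMDiffAt_totalSpace] at h
  exact contMDiffAt_iff_contDiffAt.1 h.2

theorem chartMetric_chart (hp : p ∈ e.source) (u v : Model m) : chartMetric g e (e p) u v
    = modelForm g p (chartSymmDeriv e (e p) u) (chartSymmDeriv e (e p) v) := by
  rw [chartMetric_apply, e.left_inv hp]

theorem mem_singularSet_iff_modelForm :
    p ∈ singularSet g ↔ ∃ v : Model m, v ≠ 0 ∧ ∀ w : Model m, modelForm g p v w = 0 :=
  Iff.rfl

theorem mem_singularSet_iff (he : e ∈ IsManifold.maximalAtlas (𝓡 m) ∞ M) (hp : p ∈ e.source) :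
    p ∈ singularSet g ↔ (gram (chartMetric g e) (e p)).det = 0 := by
  rw [det_gram_eq_zero_iff (chartMetric_symm (e p)), mem_singularSet_iff_modelForm]
  constructor
  · rintro ⟨v, hv, h⟩
    refine ⟨chartDeriv e p v, fun h0 => hv ?_, fun w => ?_⟩
    · rw [← chartSymmDeriv_chartDeriv he hp v, h0, map_zero]
    · rw [chartMetric_chart hp, chartSymmDeriv_chartDeriv he hp]
      exact h _
  · rintro ⟨u, hu, h⟩
    refine ⟨chartSymmDeriv e (e p) u, fun h0 => hu ?_, fun w => ?_⟩
    · rw [← chartDeriv_chartSymmDeriv he hp u]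
      rw [h0, map_zero]
    · have := h (chartDeriv e p w)
      rw [chartMetric_chart hp, chartSymmDeriv_chartDeriv he hp] at this
      exact this

theorem isClosed_singularSet (g : SymmTensor m M) : IsClosed (singularSet g) := by
  rw [← isOpen_compl_iff, isOpen_iff_mem_nhds]
  intro p hp
  have he := IsManifold.chart_mem_maximalAtlas (I := 𝓡 m) (n := ∞) p
  have hps := mem_chart_source (Model m) p
  rw [Set.mem_compl_iff, mem_singularSet_iff he hps] at hp
  have hc := ((contDiffAt_det_gram
    (contDiffAt_chartMetric g he (mem_chart_target _ p))).continuousAt.comp ((chartAt (Model m) p).continuousAt hps)).eventually_ne hp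
  filter_upwards [hc, (chartAt (Model m) p).open_source.mem_nhds hps] with q hq hqs
  rwa [Set.mem_compl_iff, mem_singularSet_iff he hqs]

theorem isLocalPullback_chart (g : SymmTensor m M) (he : e ∈ IsManifold.maximalAtlas (𝓡 m) ∞ M)
    (he' : e' ∈ IsManifold.maximalAtlas (𝓡 m) ∞ M) (hp : p ∈ e.source) (hp' : p ∈ e'.source) :
    IsLocalPullback (e' ∘ e.symm) (chartMetric g e) (chartMetric g e') (e p) ∧
      ∀ v, chartDeriv e' p v = fderiv ℝ (e' ∘ e.symm) (e p) (chartDeriv e p v) := by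
  have hx : e p ∈ e.target := e.map_source hp
  have hev : ∀ᶠ y in 𝓝 (e p), y ∈ e.target ∧ e.symm y ∈ e'.source := by
    refine Filter.Eventually.and (e.open_target.mem_nhds hx) ?_
    refine (e.continuousAt_symm hx).eventually (e'.open_source.mem_nhds ?_)
    rwa [e.left_inv hp]
  have hφ : ∀ y, y ∈ e.target → e.symm y ∈ e'.source → ∀ u,
      fderiv ℝ (e' ∘ e.symm) y u = chartDeriv e' (e.symm y) (chartSymmDeriv e y u) := by
    intro y hy hy' u
    have := mfderiv_comp y ((mDifferentiable_of_mem_maximalAtlas he').mdifferentiableAt hy')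
      ((mDifferentiable_of_mem_maximalAtlas he).mdifferentiableAt_symm hy)
    rw [← mfderiv_eq_fderiv]
    exact congrArg (fun f => f u) this
  have h0 : ∀ u, fderiv ℝ (e' ∘ e.symm) (e p) u = chartDeriv e' p (chartSymmDeriv e (e p) u) := by
    intro u
    have := hφ (e p) hx (by rwa [e.left_inv hp]) u
    rwa [e.left_inv hp] at this
  have hφp : (e' ∘ e.symm) (e p) = e' p := by simp [e.left_inv hp]
  refine ⟨⟨?_, ?_, ?_, ?_, ?_⟩, fun v => ?_⟩
  · filter_upwards [hev] with y hy
    exact contMDiffAt_iff_contDiffAt.1 ((contMDiffAt_of_mem_maximalAtlas he' hy.2).comp y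
      (contMDiffAt_symm_of_mem_maximalAtlas he hy.1))
  · rw [hφp]
    filter_upwards [e'.open_target.mem_nhds (e'.map_source hp')] with y hy
    exact contDiffAt_chartMetric g he' hy
  · filter_upwards [hev] with y hy
    exact contDiffAt_chartMetric g he hy.1
  · constructor
    · intro u v huv
      rw [h0, h0] at huv
      have := congrArg (fun z => chartDeriv e p (chartSymmDeriv e' (e' p) z)) huv
      simpa only [chartSymmDeriv_chartDeriv he' hp', chartDeriv_chartSymmDeriv he hp] using this
    · intro u
      refine ⟨chartDeriv e p (chartSymmDeriv e' (e' p) u), ?_⟩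
      rw [h0, chartSymmDeriv_chartDeriv he hp, chartDeriv_chartSymmDeriv he' hp']
  · filter_upwards [hev] with y hy u v
    rw [hφ y hy.1 hy.2, hφ y hy.1 hy.2, Function.comp_apply, chartMetric_chart hy.2,
      chartSymmDeriv_chartDeriv he' hy.2, chartSymmDeriv_chartDeriv he' hy.2, chartMetric_apply]
  · rw [h0, chartSymmDeriv_chartDeriv he hp]

/-- `ricci` uses the preferred chart of each point, which varies with the point; invariance permits
computing near `p` in one fixed chart. -/
theorem ricciInChart_eq_ricciInChart (he : e ∈ IsManifold.maximalAtlas (𝓡 m) ∞ M)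
    (he' : e' ∈ IsManifold.maximalAtlas (𝓡 m) ∞ M) (hp : p ∈ e.source) (hp' : p ∈ e'.source)
    (hsing : p ∉ singularSet g) (u v : TangentSpace (𝓡 m) p) :
    ricciInChart g e p u v = ricciInChart g e' p u v := by
  obtain ⟨h, hd⟩ := isLocalPullback_chart g he he' hp hp'
  have hφp : (e' ∘ e.symm) (e p) = e' p := by simp [e.left_inv hp]
  rw [mem_singularSet_iff he' hp'] at hsing
  refine (h.ricciLocal_eq chartMetric_symm chartMetric_symm (by rwa [hφp]) _ _).trans ?_
  rw [hφp]
  exact congrArg₂ (ricciLocal (chartMetric g e') (e' p)) (hd u).symm (hd v).symm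

theorem ricci_eq_ricciLocal (he : e ∈ IsManifold.maximalAtlas (𝓡 m) ∞ M) (hp : p ∈ e.source)
    (hsing : p ∉ singularSet g) (u v : TangentSpace (𝓡 m) p) :
    ricci g p u v = ricciLocal (chartMetric g e) (e p) (chartDeriv e p u) (chartDeriv e p v) :=
  ricciInChart_eq_ricciInChart (IsManifold.chart_mem_maximalAtlas p) he (mem_chart_source _ p) hp
    hsing u v

/-- Polarization: if `u'`, `v'` come from fields vanishing on `Σ`, all four terms on the right come
from extensions of the same two fields along `Σ`. -/
theorem ricci_add_add (hsing : p ∉ singularSet g) (u u' v v' : TangentSpace (𝓡 m) p) :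
    ricci g p u' v' = ricci g p (u + u') (v + v') - ricci g p (u + u') v
      - ricci g p u (v + v') + ricci g p u v := by
  have he := IsManifold.chart_mem_maximalAtlas (I := 𝓡 m) (n := ∞) p
  have hp := mem_chart_source (Model m) p
  have hG := contDiffAt_chartMetric g he (mem_chart_target _ p)
  have hdet := hsing
  rw [mem_singularSet_iff he hp] at hdet
  have hadd : ∀ a b : TangentSpace (𝓡 m) p, chartDeriv (chartAt (Model m) p) p (a + b)
    = chartDeriv (chartAt (Model m) p) p a + chartDeriv (chartAt (Model m) p) p b :=
    fun a b => map_add (chartDeriv (chartAt (Model m) p) p) a b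
  simp only [ricci_eq_ricciLocal he hp hsing, hadd, ricciLocal_add_left hG hdet,
    ricciLocal_add_right hG hdet]
  ring

end Manifold

/-! ### Extensions, the test field and the contradiction. -/

section Manifold

variable {m : ℕ} {M : Type*} [TopologicalSpace M] [ChartedSpace (Model m) M]
  [IsManifold (𝓡 m) ∞ M] {g : SymmTensor m M} {p : M}

/-- Prescribing the value on `Σ` is a convex condition, so local extensions glue by a partition of
unity; off the closed set `Σ` the zero field serves. Without an extension, well-definedness would be
vacuous. -/
theorem exists_isExtension [T2Space M] [SigmaCompactSpace M] {A : FieldAlong g}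
    (hA : IsSmoothAlong g A) : ∃ A', IsExtension g A A' := by
  obtain ⟨s, hs⟩ := exists_contMDiffSection_forall_mem_convex_of_local (𝓡 m) (n := ⊤)
    (fun p : M => TangentSpace (𝓡 m) p)
    (fun p => {v | ∀ h : p ∈ singularSet g, v = A ⟨p, h⟩})
    (fun p => by
      intro u hu v hv a b _ _ hab h
      rw [hu h, hv h, ← add_smul, hab, one_smul])
    (fun p => by
      by_cases hp : p ∈ singularSet g
      · obtain ⟨U, hU, A', hA', h⟩ := hA ⟨p, hp⟩
        exact ⟨U, hU, A', hA', fun q hq hqs => h ⟨q, hqs⟩ hq⟩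
      · refine ⟨(singularSet g)ᶜ, (isClosed_singularSet g).isOpen_compl.mem_nhds hp, fun _ => 0,
          ?_, fun q hq hqs => absurd hqs hq⟩
        exact (Bundle.contMDiff_zeroSection ℝ (fun p : M => TangentSpace (𝓡 m) p)).contMDiffOn)
  exact ⟨s, s.contMDiff.contMDiffOn, fun q => hs q q.2⟩

/-- If `Ric(A,B)` is well-defined, then `Ric(X,X)` tends to zero on `Σ` for every smooth field `X`
vanishing on `Σ`. -/
theorem RicciWellDefined.exists_continuous [T2Space M] [SigmaCompactSpace M] {A B : FieldAlong g}
    (hA : IsSmoothAlong g A) (hB : IsSmoothAlong g B) (h : RicciWellDefined g A B)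
    {X : ∀ p : M, TangentSpace (𝓡 m) p} (hX : IsSmoothField X Set.univ)
    (hX0 : ∀ q ∈ singularSet g, X q = 0) :
    ∃ H : M → ℝ, Continuous H ∧ (∀ q ∈ singularSet g, H q = 0) ∧
      ∀ q ∉ singularSet g, H q = ricci g q (X q) (X q) := by
  obtain ⟨r, hr⟩ := h
  obtain ⟨A', hA'⟩ := exists_isExtension hA
  obtain ⟨B', hB'⟩ := exists_isExtension hB
  have hAX : IsExtension g A (A' + X) :=
    ⟨hA'.1.add_section hX, fun q => by simp [hA'.2, hX0 q q.2]⟩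
  have hBX : IsExtension g B (B' + X) :=
    ⟨hB'.1.add_section hX, fun q => by simp [hB'.2, hX0 q q.2]⟩
  obtain ⟨F₁, ⟨hF₁, hF₁'⟩, hr₁⟩ := hr _ _ hAX hBX
  obtain ⟨F₂, ⟨hF₂, hF₂'⟩, hr₂⟩ := hr _ _ hAX hB'
  obtain ⟨F₃, ⟨hF₃, hF₃'⟩, hr₃⟩ := hr _ _ hA' hBX
  obtain ⟨F₄, ⟨hF₄, hF₄'⟩, hr₄⟩ := hr _ _ hA' hB'
  -- All four limits restrict to the same `r` on `Σ`, so the alternating sum vanishes there.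
  refine ⟨fun q => F₁ q - F₂ q - F₃ q + F₄ q,
    ((hF₁.continuous.sub hF₂.continuous).sub hF₃.continuous).add hF₄.continuous, ?_, ?_⟩
  · intro q hq
    have h₁ := hr₁ ⟨q, hq⟩
    have h₂ := hr₂ ⟨q, hq⟩
    have h₃ := hr₃ ⟨q, hq⟩
    have h₄ := hr₄ ⟨q, hq⟩
    simp only [h₁, h₂, h₃, h₄]
    ring
  · intro q hq
    simp only [hF₁' q hq, hF₂' q hq, hF₃' q hq, hF₄' q hq]
    exact (ricci_add_add hq (A' q) (X q) (B' q) (X q)).symm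

/-- The determinant of `(g_ab)` in the preferred chart at `p`. -/
def detAt (g : SymmTensor m M) (p : M) (x : Model m) : ℝ :=
  (gram (chartMetric g (chartAt (Model m) p)) x).det

theorem contDiffAt_detAt (g : SymmTensor m M) {x : Model m}
    (hx : x ∈ (chartAt (Model m) p).target) : ContDiffAt ℝ ∞ (detAt g p) x :=
  contDiffAt_det_gram (contDiffAt_chartMetric g (IsManifold.chart_mem_maximalAtlas p) hx)

theorem contMDiffOn_detAt_chart (g : SymmTensor m M) (p : M) :
    ContMDiffOn (𝓡 m) 𝓘(ℝ) ∞ (fun q => detAt g p (chartAt (Model m) p q))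
      (chartAt (Model m) p).source := fun q hq =>
  ((contDiffAt_detAt g ((chartAt (Model m) p).map_source hq)).contMDiffAt.comp q
    (contMDiffAt_of_mem_maximalAtlas (IsManifold.chart_mem_maximalAtlas p)
      hq)).contMDiffWithinAt

theorem detAt_chart_eq_zero {q : M} (hq : q ∈ (chartAt (Model m) p).source)
    (hqs : q ∈ singularSet g) : detAt g p (chartAt (Model m) p q) = 0 :=
  (mem_singularSet_iff (IsManifold.chart_mem_maximalAtlas p) hq).1 hqs

section Bump

variable (f : SmoothBumpFunction (𝓡 m) p)

theorem bump_mul_detAt_eq_zero {q : M} (hqs : q ∈ singularSet g) :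
    f q * detAt g p (chartAt (Model m) p q) = 0 := by
  by_cases hq : q ∈ (chartAt (Model m) p).source
  · rw [detAt_chart_eq_zero hq hqs, mul_zero]
  · rw [Function.notMem_support.1 fun h => hq (f.support_subset_source h), zero_mul]

/-- A vector tangent to `Σ` is annihilated by the differential of the local determinant. -/
theorem fderiv_detAt_chartDeriv_eq_zero [T2Space M] {v : TangentSpace (𝓡 m) p}
    (hv : TangentToSingularSet g p v) :
    fderiv ℝ (detAt g p) (chartAt (Model m) p p) (chartDeriv (chartAt (Model m) p) p v) = 0 := by
  have f : SmoothBumpFunction (𝓡 m) p := Classical.choice inferInstance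
  have hps := mem_chart_source (Model m) p
  -- Tangency is tested on global functions; the cut-off determinant is one, and agrees with the
  -- determinant near `p`.
  have hsm : ContMDiff (𝓡 m) 𝓘(ℝ) ∞ (fun q => f q * detAt g p (chartAt (Model m) p q)) :=
    f.contMDiff_smul (contMDiffOn_detAt_chart g p)
  have h1 := hv _ hsm fun q hq => bump_mul_detAt_eq_zero f hq
  have h2 : (fun q => f q * detAt g p (chartAt (Model m) p q))
      =ᶠ[𝓝 p] detAt g p ∘ chartAt (Model m) p := by
    filter_upwards [f.eventuallyEq_one] with q hq
    simp [hq]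
  have h3 := mfderiv_comp p
    ((contDiffAt_detAt g (mem_chart_target _ p)).contMDiffAt.mdifferentiableAt (by simp))
    ((mDifferentiable_of_mem_maximalAtlas
      (IsManifold.chart_mem_maximalAtlas p)).mdifferentiableAt hps)
  have h4 : mfderiv (𝓡 m) 𝓘(ℝ) (fun q => f q * detAt g p (chartAt (Model m) p q)) p
    = mfderiv (𝓡 m) 𝓘(ℝ) (detAt g p ∘ chartAt (Model m) p) p := h2.mfderiv_eq
  rw [h4, h3] at h1
  rw [← mfderiv_eq_fderiv]
  exact h1

/-- A smooth field that vanishes on `Σ` and is `det (g_ab) w` in coordinates near `p`. -/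
def scaledField (g : SymmTensor m M) (f : SmoothBumpFunction (𝓡 m) p) (w : Model m) (q : M) :
    TangentSpace (𝓡 m) q :=
  (f q * detAt g p (chartAt (Model m) p q)) •
    (chartSymmDeriv (chartAt (Model m) p) (chartAt (Model m) p q) w : TangentSpace (𝓡 m) q)

theorem isSmoothField_scaledField [T2Space M] (w : Model m) :
    IsSmoothField (scaledField g f w) Set.univ := by
  have he := IsManifold.chart_mem_maximalAtlas (I := 𝓡 m) (n := ∞) p
  have hV : ContMDiffOn (𝓡 m) (𝓡 m).tangent ∞ (fun q => (⟨q,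
      (chartSymmDeriv (chartAt (Model m) p) (chartAt (Model m) p q) w : TangentSpace (𝓡 m) q)⟩ :
        TangentBundle (𝓡 m) M)) (chartAt (Model m) p).source := by
    -- Moves a model vector between the base points `e.symm (e q')` and `q'`, which are equal only
    -- propositionally.
    have hmk : ∀ (b b' : M) (_ : b = b') (v : Model m),
        (⟨b, v⟩ : TangentBundle (𝓡 m) M) = ⟨b', v⟩ := by
      rintro b _ rfl v
      rfl
    intro q hq
    have h := (contMDiffAt_chartSymmDeriv he ((chartAt (Model m) p).map_source hq) w).comp q
      (contMDiffAt_of_mem_maximalAtlas he hq)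
    refine (h.congr_of_eventuallyEq ?_).contMDiffWithinAt
    filter_upwards [(chartAt (Model m) p).open_source.mem_nhds hq] with q' hq'
    exact hmk _ _ ((chartAt (Model m) p).left_inv hq').symm _
  have h1 := (contMDiffOn_detAt_chart g p).smul_section hV
  have h2 := ContMDiffOn.smul_section_of_tsupport f.contMDiff.contMDiffOn (chartAt (Model m) p).open_source
    f.tsupport_subset_chartAt_source h1
  refine h2.contMDiffOn.congr fun q _ => ?_
  simp only [scaledField, mul_smul]
  rfl

theorem scaledField_eq_zero (w : Model m) {q : M} (hqs : q ∈ singularSet g) :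
    scaledField g f w q = 0 := by
  rw [scaledField, bump_mul_detAt_eq_zero f hqs, zero_smul]
  rfl

/-- Each argument contributes one factor `det`, exactly what cancels the poles of `Ric(w,w)`. -/
theorem ricci_scaledField (w : Model m) {q : M} (hq : q ∈ (chartAt (Model m) p).source)
    (hqs : q ∉ singularSet g) (hf : f q = 1) :
    ricci g q (scaledField g f w q) (scaledField g f w q)
      = ricciNum (chartMetric g (chartAt (Model m) p)) w (chartAt (Model m) p q) := by
  have he := IsManifold.chart_mem_maximalAtlas (I := 𝓡 m) (n := ∞) p
  have hdet := hqs
  rw [mem_singularSet_iff he hq] at hdet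
  have hG := contDiffAt_chartMetric g he ((chartAt (Model m) p).map_source hq)
  have h1 : chartDeriv (chartAt (Model m) p) q (scaledField g f w q)
      = detAt g p (chartAt (Model m) p q) • w := by
    have : chartDeriv (chartAt (Model m) p) q
        ((f q * detAt g p (chartAt (Model m) p q)) •
          chartSymmDeriv (chartAt (Model m) p) (chartAt (Model m) p q) w)
        = detAt g p (chartAt (Model m) p q) • w := by
      rw [map_smul, chartDeriv_chartSymmDeriv he hq, hf, one_mul]
    exact this
  rw [ricci_eq_ricciLocal he hq hqs, h1, ricciLocal_smul_smul hG hdet, detAt,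
    sq_det_mul_ricciLocal hG hdet]

end Bump

/-- The smooth extension of `det² Ric(w,w)` is nonzero at singular points for some `w`. -/
theorem exists_ricciNum_ne_zero [T2Space M] (hp : p ∈ singularSet g)
    (htransverse : IsTransverse g) (htangent : HasTangentRadical g) :
    ∃ w, fderiv ℝ (detAt g p) (chartAt (Model m) p p) w ≠ 0 ∧
      ricciNum (chartMetric g (chartAt (Model m) p)) w (chartAt (Model m) p p) ≠ 0 := by
  have he := IsManifold.chart_mem_maximalAtlas (I := 𝓡 m) (n := ∞) p
  have hps := mem_chart_source (Model m) p
  have hd : fderiv ℝ (detAt g p) (chartAt (Model m) p p) ≠ 0 := htransverse _ he p hps hp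
  obtain ⟨w, hw⟩ : ∃ w, fderiv ℝ (detAt g p) (chartAt (Model m) p p) w ≠ 0 := by
    by_contra! h
    exact hd (ContinuousLinearMap.ext h)
  refine ⟨w, hw, ?_⟩
  have h := ricciNum_eq (contDiffAt_chartMetric g he (mem_chart_target _ p)) chartMetric_symm
    ((mem_singularSet_iff he hps).1 hp) hd (fun R hR => ?_) w
  · rw [h]
    exact div_ne_zero (neg_ne_zero.2 (pow_ne_zero 2 hw)) (by norm_num)
  · have hrad : ∀ u : Model m, modelForm g p
        (chartSymmDeriv (chartAt (Model m) p) (chartAt (Model m) p p) R) u = 0 := by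
      intro u
      have := hR (chartDeriv (chartAt (Model m) p) p u)
      rwa [chartMetric_chart hps, chartSymmDeriv_chartDeriv he hps] at this
    have h1 := fderiv_detAt_chartDeriv_eq_zero (htangent p hp
      (chartSymmDeriv (chartAt (Model m) p) (chartAt (Model m) p p) R) hrad)
    have h2 := chartDeriv_chartSymmDeriv he hps R
    exact (congrArg (fderiv ℝ (detAt g p) (chartAt (Model m) p p)) h2).symm.trans h1

theorem not_ricciWellDefined [T2Space M] [SigmaCompactSpace M]
    (hne : (singularSet g).Nonempty) (htransverse : IsTransverse g)
    (htangent : HasTangentRadical g) {A B : FieldAlong g}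
    (hA : IsSmoothAlong g A) (hB : IsSmoothAlong g B) : ¬ RicciWellDefined g A B := by
  intro h
  obtain ⟨p, hp⟩ := hne
  have he := IsManifold.chart_mem_maximalAtlas (I := 𝓡 m) (n := ∞) p
  have hps := mem_chart_source (Model m) p
  set e := chartAt (Model m) p with he_def
  have hpt : e p ∈ e.target := e.map_source hps
  obtain ⟨w, hw, hne⟩ := exists_ricciNum_ne_zero hp htransverse htangent
  have f : SmoothBumpFunction (𝓡 m) p := Classical.choice inferInstance
  obtain ⟨H, hH, hH0, hHric⟩ := h.exists_continuous hA hB (isSmoothField_scaledField f w)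
    (fun q hq => scaledField_eq_zero f w hq)
  have hline : HasDerivAt (fun t : ℝ => e p + t • w) w 0 := by
    simpa using ((hasDerivAt_id (0 : ℝ)).smul_const w).const_add (e p)
  have hline0 : Filter.Tendsto (fun t : ℝ => e p + t • w) (𝓝[≠] 0) (𝓝 (e p)) := by
    have := hline.continuousAt.tendsto
    simp only [zero_smul, add_zero] at this
    exact this.mono_left nhdsWithin_le_nhds
  -- The determinant has derivative `d det (w) ≠ 0` along the line at `t = 0`, so the line leaves
  -- `Σ` immediately.
  have hdet : ∀ᶠ t : ℝ in 𝓝[≠] 0, detAt g p (e p + t • w) ≠ 0 := by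
    have hd := ((contDiffAt_detAt g hpt).differentiableAt (by simp)).hasFDerivAt
    have hd' : HasFDerivAt (detAt g p) (fderiv ℝ (detAt g p) (e p)) (e p + (0 : ℝ) • w) := by
      simpa using hd
    exact (hd'.comp_hasDerivAt (0 : ℝ) hline).eventually_ne hw
  have hsymm : Filter.Tendsto e.symm (𝓝 (e p)) (𝓝 p) := by
    have := e.continuousAt_symm hpt
    rwa [ContinuousAt, e.left_inv hps] at this
  have hlim1 : Filter.Tendsto (fun t : ℝ => H (e.symm (e p + t • w))) (𝓝[≠] 0) (𝓝 0) := by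
    have := (hH.tendsto p).comp (hsymm.comp hline0)
    rwa [hH0 p hp] at this
  have hlim2 : Filter.Tendsto (fun t : ℝ => ricciNum (chartMetric g e) w (e p + t • w)) (𝓝[≠] 0)
      (𝓝 (ricciNum (chartMetric g e) w (e p))) :=
    (continuousAt_ricciNum (contDiffAt_chartMetric g he hpt) w).tendsto.comp hline0
  -- For small `t ≠ 0` both functions equal `Ric(X,X)` on the line, so their limits at `p` agree and
  -- `ricciNum` would vanish there.
  refine hne (tendsto_nhds_unique (hlim2.congr' ?_) hlim1)
  filter_upwards [hdet, hline0.eventually (e.open_target.mem_nhds hpt),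
    hline0.eventually (hsymm.eventually f.eventuallyEq_one)] with t h1 h2 h3
  have hs : e.symm (e p + t • w) ∈ e.source := e.map_target h2
  have hns : e.symm (e p + t • w) ∉ singularSet g := by
    rw [mem_singularSet_iff he hs, e.right_inv h2]
    exact h1
  rw [hHric _ hns, ricci_scaledField f w hs hns h3, ← he_def, e.right_inv h2]

end Manifold

end SingularSpace

end

theorem mainTheorem11 {m : ℕ} (hm : 2 < m) {M : Type*} [TopologicalSpace M] [T2Space M]
    [SecondCountableTopology M] [ConnectedSpace M]
    [ChartedSpace (EuclideanSpace ℝ (Fin m)) M] [IsManifold (𝓡 m) ∞ M]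
    (g : SingularSpace.SymmTensor m M)
    (hne : (SingularSpace.singularSet g).Nonempty)
    (htransverse : SingularSpace.IsTransverse g)
    (htangent : SingularSpace.HasTangentRadical g)
    (hsignature : SingularSpace.IsRiemannLorentz g)
    (A B : SingularSpace.FieldAlong g)
    (hA : SingularSpace.IsSmoothAlong g A) (hB : SingularSpace.IsSmoothAlong g B) :
    ¬ SingularSpace.RicciWellDefined g A B := by
  -- With second countability this gives σ-compactness, as the partition of unity requires.
  have : LocallyCompactSpace M :=
    ChartedSpace.locallyCompactSpace (EuclideanSpace ℝ (Fin m)) M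
  exact SingularSpace.not_ricciWellDefined hne htransverse htangent hA hB
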